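/- Call a set $R\subset\mathbb{R}^d$ a dyadic interval of dimensions $2^{n_1}\times\dots\times 2^{n_d}$ ($n_i\in\mathbb{Z}$) if $R=\prod_{i=1}^d[j_i2^{n_i},(j_i+1)2^{n_i})$ for some $j_1,\dots,j_d\in\mathbb{Z}$. A collection $\mathcal{B}$ of bounded measurable subsets of $\mathbb{R}^d$ is said to differentiate a class $X$ of functions on $\mathbb{R}^d$ if for every $f\in X$ and almost every $x\in\mathbb{R}^d$, $$\lim_{n\to\infty}\frac{1}{|R_n|}\int_{R_n}f(y)\,dy=f(x)$$ for every sequence $(R_n)$ of elements of $\mathcal{B}$ containing $x$ whose diameters converge to $0$. Let $L(\log^+L)^{a}$ be the class of measurable $f:\mathbb{R}^d\to\mathbb{R}$ with $\int_{\mathbb{R}^d}|f|(\log^+|f|)^{a}<\infty$ (so that it is $L^1$ for $a=0$). **Theorem.** For all integers $2\le k\le d$ there exist functions $\Phi_1,\dots,\Phi_d:\mathbb{Z}^k\to\mathbb{Z}$, each non-decreasing in each variable, such that the collection of all dyadic intervals of dimensions $2^{\Phi_1(m)}\times\dots\times2^{\Phi_d(m)}$, $m\in\mathbb{Z}^k$,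 does not differentiate $L(\log^+L)^{d-2}$. -/

import Mathlib

open MeasureTheory Filter Topology

namespace ZygmundBasis

/-- The standard half-open dyadic interval of `ℝ^d` with side lengths `2 ^ (n 1), …, 2 ^ (n d)`
and position `j`: the product of the intervals `[j i * 2 ^ (n i), (j i + 1) * 2 ^ (n i))`. -/
def dyadicInterval {d : ℕ} (n j : Fin d → ℤ) : Set (Fin d → ℝ) :=
  Set.pi Set.univ fun i =>
    Set.Ico ((j i : ℝ) * (2 : ℝ) ^ (n i)) (((j i : ℝ) + 1) * (2 : ℝ) ^ (n i))

/-- A function of `k` integer variables is non-decreasing in each variable separately. -/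
def NondecreasingInEachVariable {k : ℕ} (φ : (Fin k → ℤ) → ℤ) : Prop :=
  ∀ (m : Fin k → ℤ) (l : Fin k), Monotone fun t : ℤ => φ (Function.update m l t)

/-- The collection of all dyadic intervals with dimensions
`2 ^ (Φ 1 m) × ⋯ × 2 ^ (Φ d m)` for some `m ∈ ℤ^k`. -/
def dyadicBasis {k d : ℕ} (Φ : Fin d → (Fin k → ℤ) → ℤ) : Set (Set (Fin d → ℝ)) :=
  {R | ∃ (m : Fin k → ℤ) (j : Fin d → ℤ), R = dyadicInterval (fun i => Φ i m) j}

/-- The class `L (log⁺ L) ^ a` on `ℝ^d`: measurable `f` with `∫ |f| (log⁺ |f|) ^ a < ∞`.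
For `a = 0` this is `L¹`. Every member is locally integrable, as
`|f| ≤ e + |f| (log⁺ |f|) ^ a`. -/
def LLogL (d a : ℕ) : Set ((Fin d → ℝ) → ℝ) :=
  {f | AEStronglyMeasurable f volume ∧
    Integrable (fun x => |f x| * Real.posLog |f x| ^ a) volume}

/-- The basis `B` differentiates the function space `X`: for every `f ∈ X` and almost every `x`,
the averages of `f` over any sequence of elements of `B` that contain `x` and have diameters
tending to `0` converge to `f x`. (That diameters tend to `0` does not depend on
the choice of the norm on `ℝ^d`.) -/
def Differentiates {d : ℕ} (B : Set (Set (Fin d → ℝ))) (X : Set ((Fin d → ℝ) → ℝ)) : Prop :=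
  ∀ f ∈ X, ∀ᵐ x ∂(volume : Measure (Fin d → ℝ)),
    ∀ R : ℕ → Set (Fin d → ℝ), (∀ n, R n ∈ B ∧ x ∈ R n) →
      Tendsto (fun n => Metric.ediam (R n)) atTop (𝓝 0) →
      Tendsto (fun n => (volume.real (R n))⁻¹ * ∫ y in R n, f y) atTop (𝓝 (f x))

end ZygmundBasis

namespace ZygmundBasis

/-! Monotonicity barely constrains the exponents. On each level m 0 + m 1 = c, `levelExponent`
enumerates all vectors with entries in the window [top (c - 1), top c]. Windows of different levels
are ordered, so the enumeration inside a level may be arbitrary. The basis thus contains every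
dyadic box within each window of scales, and a strong-basis counterexample applies.

In a window of length L = d r, each large cell carries a bump of height 2^L on a corner cube of
relative volume 2^(-L d). The boxes at that corner with 2^L times the volume of the cube have
average at least 1. Their union, `staircase`, has relative volume at least of order r^(d-1) 2^(L - L
d), while the bumps cost about r^(d-2) 2^(L - L d) in L(log⁺ L)^(d-2): see
`exists_le_mul_volume_staircase`. Hence the costs can have sum below 1 while the staircase volumes
diverge (`exists_seq_tsum_lt_one_tsum_eq_top`).

Successive windows behave independently, so by a Borel–Cantelli argument
(`ae_frequently_mem_cellPosition_preimage`) almost every point of the unit cube lies in infinitely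
many staircases. The supremum of the bumps vanishes on a subset of positive measure, where averages
that are at least 1 recur at arbitrarily small scales. -/

/-! ### Volume and diameter of dyadic intervals. -/

theorem volume_dyadicInterval {d : ℕ} (n j : Fin d → ℤ) :
    volume (dyadicInterval n j) = ENNReal.ofReal ((2 : ℝ) ^ (∑ i, n i)) := by
  have h : ∀ s : Finset (Fin d), (2 : ℝ) ^ (∑ i ∈ s, n i) = ∏ i ∈ s, (2 : ℝ) ^ n i := by
    intro s
    induction s using Finset.induction_on with
    | empty => simp
    | insert a s ha ih =>
      rw [Finset.sum_insert ha, Finset.prod_insert ha, zpow_add₀ (by norm_num), ih]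
  rw [dyadicInterval, Real.volume_pi_Ico, h, ENNReal.ofReal_prod_of_nonneg (fun i _ => by positivity)]
  congr 1
  ext i
  congr 1
  ring

theorem measurableSet_dyadicInterval {d : ℕ} (n j : Fin d → ℤ) :
    MeasurableSet (dyadicInterval n j) :=
  MeasurableSet.univ_pi fun _ => measurableSet_Ico

theorem ediam_dyadicInterval_le {d : ℕ} (n j : Fin d → ℤ) (N : ℤ) (h : ∀ i, n i ≤ N) :
    Metric.ediam (dyadicInterval n j) ≤ ENNReal.ofReal ((2 : ℝ) ^ N) := by
  refine Metric.ediam_le fun x hx y hy => ?_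
  rw [edist_dist]
  refine ENNReal.ofReal_le_ofReal ((dist_pi_le_iff (by positivity)).2 fun i => ?_)
  have hx := hx i trivial
  have hy := hy i trivial
  have hN : (2 : ℝ) ^ n i ≤ 2 ^ N := zpow_le_zpow_right₀ (by norm_num) (h i)
  rw [Real.dist_eq, abs_le]
  constructor <;> nlinarith [hx.1, hx.2, hy.1, hy.2]

/-! ### Monotone functions that enumerate windows of exponents. -/

/-- The exponents attached to `m`: on each level set of `m 0 + m 1` they run through all vectors
with entries between two consecutive values of `top`. -/
def levelExponent {d k : ℕ} (hk : 2 ≤ k) (top : ℤ → ℤ) (i : Fin d) (m : Fin k → ℤ) : ℤ :=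
  min (top (m ⟨0, by omega⟩ + m ⟨1, by omega⟩))
    (top (m ⟨0, by omega⟩ + m ⟨1, by omega⟩ - 1) +
      (((Encodable.decode (α := Fin d → ℕ) (m ⟨0, by omega⟩).toNat).getD 0 i : ℕ) : ℤ))

/-- Raising `m 0` or `m 1` raises their sum c, and every value on level c is at most top c, which
bounds the values on higher levels from below. The other variables play no role. -/
theorem levelExponent_nondecreasing {d k : ℕ} (hk : 2 ≤ k) {top : ℤ → ℤ} (htop : Monotone top)
    (i : Fin d) : NondecreasingInEachVariable (levelExponent hk top i) := by
  have key : ∀ m m' : Fin k → ℤ,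
      m ⟨0, by omega⟩ + m ⟨1, by omega⟩ < m' ⟨0, by omega⟩ + m' ⟨1, by omega⟩ →
      levelExponent hk top i m ≤ levelExponent hk top i m' := by
    intro m m' h
    refine (min_le_left _ _).trans (le_min (htop h.le) ?_)
    have := htop (show m ⟨0, by omega⟩ + m ⟨1, by omega⟩ ≤
      m' ⟨0, by omega⟩ + m' ⟨1, by omega⟩ - 1 by omega)
    omega
  intro m l t t' htt
  rcases htt.eq_or_lt with rfl | hlt
  · exact le_rfl
  by_cases h0 : l = ⟨0, by omega⟩
  · subst h0
    exact key _ _ (by simpa [Function.update] using hlt)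
  by_cases h1 : l = ⟨1, by omega⟩
  · subst h1
    exact key _ _ (by simpa [Function.update] using hlt)
  · have h0' : (⟨0, by omega⟩ : Fin k) ≠ l := fun h => h0 h.symm
    have h1' : (⟨1, by omega⟩ : Fin k) ≠ l := fun h => h1 h.symm
    simp [levelExponent, Function.update_of_ne h0', Function.update_of_ne h1']

/-- `m 0` carries the code of the offset vector v - top (c - 1), and `m 1` restores the sum c. -/
theorem exists_levelExponent_eq {d k : ℕ} (hk : 2 ≤ k) (top : ℤ → ℤ) (c : ℤ) (v : Fin d → ℤ)
    (h1 : ∀ i, top (c - 1) ≤ v i) (h2 : ∀ i, v i ≤ top c) :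
    ∃ m : Fin k → ℤ, (fun i => levelExponent hk top i m) = v := by
  set w : Fin d → ℕ := fun i => (v i - top (c - 1)).toNat with hw
  refine ⟨fun l => if l = ⟨0, by omega⟩ then (Encodable.encode w : ℤ)
    else c - (Encodable.encode w : ℤ), ?_⟩
  ext i
  have : ((w i : ℕ) : ℤ) = v i - top (c - 1) := by
    simp only [hw]
    have := h1 i
    omega
  simp only [levelExponent, if_true, Fin.mk.injEq, one_ne_zero, if_false, add_sub_cancel,
    Int.toNat_natCast, Encodable.encodek, Option.getD_some, this]
  exact min_eq_right (h2 i)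

/-! ### Choice of the parameters, with repetitions. -/

/-- If the ratios `a r / u r` are arbitrarily small, then along some sequence `r` with
repetitions the series of `a` is small while the series of `u` diverges. -/
theorem exists_seq_tsum_lt_one_tsum_eq_top (a u : ℕ → ENNReal) (hu1 : ∀ r, u r ≤ 1)
    (hu0 : ∀ r, 1 ≤ r → u r ≠ 0)
    (h : ∀ ε : ENNReal, ε ≠ 0 → ∃ r, 1 ≤ r ∧ a r ≤ ε * u r) :
    ∃ ρ : ℕ → ℕ, (∀ n, 1 ≤ ρ n) ∧ ∑' n, a (ρ n) < 1 ∧ ∑' n, u (ρ n) = ⊤ := by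
  obtain ⟨ε, hε, hεs⟩ := ENNReal.exists_pos_sum_of_countable (ε := 1 / 2) (by simp) ℕ
  choose r hr1 hr using fun j => h (ε j / 2) (by simpa using (hε j).ne')
  -- About 1 / u copies of `r j` give a block with u-mass between 1 and 2, hence a-mass at most `ε
  -- j`.
  have hN : ∀ j, ∃ N : ℕ, 1 ≤ N * u (r j) ∧ N * u (r j) ≤ 2 := by
    intro j
    have h0 := hu0 (r j) (hr1 j)
    have ht : u (r j) ≠ ⊤ := ne_top_of_le_ne_top (by simp) (hu1 (r j))
    have hex : ∃ N : ℕ, 1 ≤ (N : ENNReal) * u (r j) := by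
      obtain ⟨N, hN⟩ := ENNReal.exists_nat_mul_gt h0 (b := 1) (by simp)
      exact ⟨N, hN.le⟩
    classical
    refine ⟨Nat.find hex, Nat.find_spec hex, ?_⟩
    have hpos : 0 < Nat.find hex := by
      rw [Nat.find_pos]
      simp
    have hlt := Nat.find_min hex (Nat.sub_lt hpos one_pos)
    obtain ⟨N, hN⟩ := Nat.exists_eq_succ_of_ne_zero hpos.ne'
    rw [hN] at hlt ⊢
    simp only [Nat.succ_eq_add_one, Nat.add_sub_cancel, not_le] at hlt
    calc ((N + 1 : ℕ) : ENNReal) * u (r j) = N * u (r j) + u (r j) := by push_cast; ring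
      _ ≤ 1 + 1 := add_le_add hlt.le (hu1 _)
      _ = 2 := one_add_one_eq_two
  choose N hN1 hN2 using hN
  have hNpos : ∀ j, 0 < N j := by
    intro j
    rcases Nat.eq_zero_or_pos (N j) with h | h
    · have := hN1 j
      simp [h] at this
    · exact h
  have : Infinite (Σ j, Fin (N j)) :=
    Infinite.of_injective (fun j => (⟨j, ⟨0, hNpos j⟩⟩ : Σ j, Fin (N j)))
      fun i j hij => congrArg Sigma.fst hij
  obtain ⟨e⟩ := nonempty_equiv_of_countable (α := ℕ) (β := Σ j, Fin (N j))
  refine ⟨fun n => r (e n).1, fun n => hr1 _, ?_, ?_⟩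
  · rw [e.tsum_eq (fun p : Σ j, Fin (N j) => a (r p.1)), ENNReal.tsum_sigma']
    have hb : ∀ j, ∑' _ : Fin (N j), a (r j) ≤ ε j := by
      intro j
      rw [tsum_fintype, Finset.sum_const, Finset.card_univ, Fintype.card_fin, nsmul_eq_mul]
      calc (N j : ENNReal) * a (r j) ≤ N j * (ε j / 2 * u (r j)) := by gcongr; exact hr j
        _ = ε j / 2 * (N j * u (r j)) := by ring
        _ ≤ ε j / 2 * 2 := by gcongr; exact hN2 j
        _ = ε j := ENNReal.div_mul_cancel (by simp) (by simp)
    calc _ ≤ ∑' j, (ε j : ENNReal) := ENNReal.tsum_le_tsum hb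
      _ < 1 / 2 := hεs
      _ ≤ 1 := by simp
  · rw [e.tsum_eq (fun p : Σ j, Fin (N j) => u (r p.1)), ENNReal.tsum_sigma', eq_top_iff]
    calc (⊤ : ENNReal) = ∑' _ : ℕ, 1 := by simp
      _ ≤ _ := ENNReal.tsum_le_tsum fun j => by
        simpa only [tsum_fintype, Finset.sum_const, Finset.card_univ, Fintype.card_fin,
          nsmul_eq_mul] using hN1 j

/-! ### Dyadic cells and independence of scales. -/

/-- The half-open unit cube. -/
def unitCube (d : ℕ) : Set (Fin d → ℝ) := Set.pi Set.univ fun _ => Set.Ico 0 1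

/-- The index of the dyadic cube of side `2 ^ (-b)` that contains `x`. -/
noncomputable def cellIndex {d : ℕ} (b : ℕ) (x : Fin d → ℝ) : Fin d → ℤ :=
  fun i => ⌊(2 : ℝ) ^ b * x i⌋

/-- The position of `x` in its dyadic cube of side `2 ^ (-b)`, rescaled to the unit cube. -/
noncomputable def cellPosition {d : ℕ} (b : ℕ) (x : Fin d → ℝ) : Fin d → ℝ :=
  fun i => Int.fract ((2 : ℝ) ^ b * x i)

/-- `V` is a union of dyadic cubes of side `2 ^ (-b)`. -/
def IsCellular {d : ℕ} (b : ℕ) (V : Set (Fin d → ℝ)) : Prop :=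
  ∀ ⦃x y : Fin d → ℝ⦄, cellIndex b x = cellIndex b y → x ∈ V → y ∈ V

theorem measurable_cellIndex {d : ℕ} (b : ℕ) : Measurable (cellIndex (d := d) b) :=
  measurable_pi_lambda _ fun i => Int.measurable_floor.comp ((measurable_pi_apply i).const_mul _)

theorem measurable_cellPosition {d : ℕ} (b : ℕ) : Measurable (cellPosition (d := d) b) :=
  measurable_pi_lambda _ fun i => measurable_fract.comp ((measurable_pi_apply i).const_mul _)

theorem measurableSet_unitCube (d : ℕ) : MeasurableSet (unitCube d) :=
  MeasurableSet.univ_pi fun _ => measurableSet_Ico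

theorem volume_unitCube (d : ℕ) : volume (unitCube d) = 1 := by
  simp [unitCube, Real.volume_pi_Ico]

theorem cellPosition_mem_unitCube {d : ℕ} (b : ℕ) (x : Fin d → ℝ) :
    cellPosition b x ∈ unitCube d :=
  fun _ _ => ⟨Int.fract_nonneg _, Int.fract_lt_one _⟩

theorem cellIndex_eq_of_add {d : ℕ} {b c : ℕ} {x y : Fin d → ℝ}
    (h : cellIndex (b + c) x = cellIndex (b + c) y) : cellIndex b x = cellIndex b y := by
  have key : ∀ z : Fin d → ℝ, ∀ i, cellIndex b z i = cellIndex (b + c) z i / ((2 ^ c : ℕ) : ℤ) := by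
    intro z i
    simp only [cellIndex]
    rw [← Int.floor_div_natCast]
    congr 1
    push_cast
    field_simp
    ring
  ext i
  rw [key, key, h]

theorem IsCellular.add {d : ℕ} {b : ℕ} {V : Set (Fin d → ℝ)} (h : IsCellular b V) (c : ℕ) :
    IsCellular (b + c) V :=
  fun _ _ hxy hx => h (cellIndex_eq_of_add hxy) hx

theorem IsCellular.diff {d : ℕ} {b : ℕ} {V W : Set (Fin d → ℝ)} (hV : IsCellular b V)
    (hW : IsCellular b W) : IsCellular b (V \ W) :=
  fun _ _ hxy hx => ⟨hV hxy hx.1, fun hy => hx.2 (hW hxy.symm hy)⟩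

theorem isCellular_unitCube (d b : ℕ) : IsCellular b (unitCube d) := by
  have h0 : IsCellular 0 (unitCube d) := by
    intro x y hxy hx i _
    have h1 := hx i trivial
    have h2 := congrFun hxy i
    simp only [cellIndex, pow_zero, one_mul] at h2
    rw [Int.floor_eq_zero_iff.2 h1] at h2
    exact Int.floor_eq_zero_iff.1 h2.symm
  simpa using h0.add b

/-- Since 2 ^ e is an integer, the condition depends only on floors, so it is constant on cells 2 ^
c times finer. -/
theorem fract_lt_iff_floor {t : ℝ} {e c : ℕ} :
    Int.fract t < 2 ^ e / 2 ^ c ↔ ⌊(2 : ℝ) ^ c * t⌋ < 2 ^ e + 2 ^ c * ⌊t⌋ := by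
  rw [Int.floor_lt, lt_div_iff₀ (by positivity), Int.fract]
  push_cast
  constructor <;> intro h <;> linarith

theorem isCellular_cellPosition_preimage {d : ℕ} {ι : Type*} (b c : ℕ) (e : ι → Fin d → ℕ) :
    IsCellular (b + c) (cellPosition b ⁻¹'
      ⋃ g, Set.pi Set.univ fun i => Set.Ico (0 : ℝ) (2 ^ e g i / 2 ^ c)) := by
  intro x y hxy hx
  simp only [Set.mem_preimage, Set.mem_iUnion] at hx ⊢
  obtain ⟨g, hg⟩ := hx
  refine ⟨g, fun i _ => ⟨Int.fract_nonneg _, ?_⟩⟩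
  have h1 := (hg i trivial).2
  simp only [cellPosition] at h1 ⊢
  rw [fract_lt_iff_floor] at h1 ⊢
  have h2 := congrFun (cellIndex_eq_of_add hxy) i
  have h3 := congrFun hxy i
  simp only [cellIndex] at h2 h3
  have h4 : ∀ z : ℝ, (2 : ℝ) ^ c * (2 ^ b * z) = 2 ^ (b + c) * z := fun z => by ring
  rw [h4] at h1 ⊢
  rwa [← h2, ← h3]

theorem volume_cell_inter {d : ℕ} (b : ℕ) (q : Fin d → ℤ) {P : Set (Fin d → ℝ)}
    (hP : P ⊆ unitCube d) :
    volume (cellIndex b ⁻¹' {q} ∩ cellPosition b ⁻¹' P) =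
      ENNReal.ofReal |(((2 : ℝ) ^ b) ^ d)⁻¹| * volume P := by
  have hset : cellIndex b ⁻¹' {q} ∩ cellPosition b ⁻¹' P =
      (fun x : Fin d → ℝ => (2 : ℝ) ^ b • x) ⁻¹'
        ((fun x => x + (fun i => -(q i : ℝ))) ⁻¹' P) := by
    ext x
    simp only [Set.mem_inter_iff, Set.mem_preimage, Set.mem_singleton_iff]
    constructor
    · rintro ⟨h1, h2⟩
      convert h2 using 1
      ext i
      simp [← h1, cellPosition, cellIndex, Int.fract, sub_eq_add_neg]
    · intro h
      have hq : cellIndex b x = q := by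
        ext i
        have := hP h i trivial
        simp only [Pi.add_apply, Pi.smul_apply, smul_eq_mul] at this
        simp only [cellIndex, Int.floor_eq_iff]
        constructor <;> linarith [this.1, this.2]
      refine ⟨hq, ?_⟩
      convert h using 1
      ext i
      simp [← hq, cellPosition, cellIndex, Int.fract, sub_eq_add_neg]
  rw [hset, Measure.addHaar_preimage_smul _ (by positivity), measure_preimage_add_right]
  simp

/-- A union of dyadic cubes is independent of the position inside the dyadic cubes. -/
theorem volume_inter_cellPosition_preimage {d : ℕ} {b : ℕ} {V P : Set (Fin d → ℝ)}
    (hV : IsCellular b V) (hVm : MeasurableSet V) (hP : P ⊆ unitCube d) (hPm : MeasurableSet P) :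
    volume (V ∩ cellPosition b ⁻¹' P) = volume V * volume P := by
  classical
  set κ : ENNReal := ENNReal.ofReal |(((2 : ℝ) ^ b) ^ d)⁻¹| with hκ
  have key : ∀ Q : Set (Fin d → ℝ), Q ⊆ unitCube d → MeasurableSet Q →
      volume (V ∩ cellPosition b ⁻¹' Q) =
        (∑' q : Fin d → ℤ, if cellIndex b ⁻¹' {q} ⊆ V then κ else 0) * volume Q := by
    intro Q hQ hQm
    have hU : V ∩ cellPosition b ⁻¹' Q =
        ⋃ q : Fin d → ℤ, (cellIndex b ⁻¹' {q} ∩ (V ∩ cellPosition b ⁻¹' Q)) := by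
      ext x
      simp
    rw [hU, measure_iUnion, ← ENNReal.tsum_mul_right]
    · refine tsum_congr fun q => ?_
      split_ifs with h
      · rw [← volume_cell_inter b q hQ, ← Set.inter_assoc, Set.inter_eq_left.2 h]
      · have : cellIndex b ⁻¹' {q} ∩ (V ∩ cellPosition b ⁻¹' Q) = ∅ := by
          by_contra hne
          obtain ⟨x, hx, hxV, -⟩ := Set.nonempty_iff_ne_empty.2 hne
          exact h fun y hy => hV (hx.trans (Eq.symm hy)) hxV
        rw [this, measure_empty, zero_mul]
    · intro q q' hqq
      refine Set.disjoint_left.2 fun x hx hx' => hqq ?_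
      exact (hx.1 : cellIndex b x = q).symm.trans hx'.1
    · intro q
      exact (measurable_cellIndex b (measurableSet_singleton q)).inter
        (hVm.inter (measurable_cellPosition b hQm))
  -- The whole cube as `Q` identifies the sum over cells with the volume of `V`, so the cells need
  -- not be counted.
  have hone := key (unitCube d) subset_rfl (measurableSet_unitCube d)
  have : V ∩ cellPosition b ⁻¹' unitCube d = V :=
    Set.inter_eq_left.2 fun x _ => cellPosition_mem_unitCube b x
  rw [this, volume_unitCube, mul_one] at hone
  rw [key P hP hPm, ← hone]

/-! ### A Borel–Cantelli argument. -/

/-- Successive refinements with divergent total volume hit almost every point of the cube. -/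
theorem volume_unitCube_diff_iUnion {d : ℕ} (B : ℕ → ℕ) (P : ℕ → Set (Fin d → ℝ))
    (hP : ∀ n, P n ⊆ unitCube d) (hPm : ∀ n, MeasurableSet (P n)) (hB : Monotone B)
    (hcell : ∀ n, IsCellular (B (n + 1)) (cellPosition (B n) ⁻¹' P n))
    (hdiv : ∑' n, volume (P n) = ⊤) :
    volume (unitCube d \ ⋃ n, cellPosition (B n) ⁻¹' P n) = 0 := by
  set V : ℕ → Set (Fin d → ℝ) := fun N =>
    unitCube d \ ⋃ n ∈ Finset.range N, cellPosition (B n) ⁻¹' P n with hVdef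
  have hVsucc : ∀ N, V (N + 1) = V N \ cellPosition (B N) ⁻¹' P N := by
    intro N
    ext x
    simp only [hVdef, Finset.mem_range, Set.mem_sdiff, Set.mem_iUnion, not_exists, Nat.lt_succ_iff]
    constructor
    · rintro ⟨h1, h2⟩
      exact ⟨⟨h1, fun n hn => h2 n hn.le⟩, h2 N le_rfl⟩
    · rintro ⟨⟨h1, h2⟩, h3⟩
      refine ⟨h1, fun n hn => ?_⟩
      rcases hn.eq_or_lt with rfl | hn
      · exact h3
      · exact h2 n hn
  have hVm : ∀ N, MeasurableSet (V N) := fun N =>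
    (measurableSet_unitCube d).diff
      (Finset.measurableSet_biUnion _ fun n _ => measurable_cellPosition _ (hPm n))
  have hVc : ∀ N, IsCellular (B N) (V N) := by
    intro N
    induction N with
    | zero => simpa [hVdef] using isCellular_unitCube d (B 0)
    | succ N ih =>
      rw [hVsucc]
      refine IsCellular.diff ?_ (hcell N)
      obtain ⟨c, hc⟩ := Nat.exists_eq_add_of_le (hB (Nat.le_succ N))
      rw [hc]
      exact ih.add c
  set S := unitCube d \ ⋃ n, cellPosition (B n) ⁻¹' P n with hS
  have hSV : ∀ N, S ⊆ V N := fun N x hx =>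
    ⟨hx.1, fun h => hx.2 (by
      simp only [Set.mem_iUnion] at h ⊢
      obtain ⟨n, -, hn⟩ := h
      exact ⟨n, hn⟩)⟩
  by_contra hne
  -- The sets of points hit for the first time at stage N are disjoint.
  have hle : ∑' N, volume (V N ∩ cellPosition (B N) ⁻¹' P N) ≤ volume (unitCube d) := by
    refine (tsum_meas_le_meas_iUnion_of_disjoint volume
      (fun N => (hVm N).inter (measurable_cellPosition _ (hPm N))) ?_).trans
      (measure_mono (Set.iUnion_subset fun N x hx => hx.1.1))
    refine (pairwise_disjoint_on _).2 fun m n hmn => Set.disjoint_left.2 fun x hx hx' => hx'.1.2 ?_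
    simp only [Set.mem_iUnion]
    exact ⟨m, Finset.mem_range.2 hmn, hx.2⟩
  have hge : volume S * ∑' n, volume (P n) ≤ 1 := by
    rw [← ENNReal.tsum_mul_left, ← volume_unitCube d]
    refine (ENNReal.tsum_le_tsum fun N => ?_).trans hle
    rw [volume_inter_cellPosition_preimage (hVc N) (hVm N) (hP N) (hPm N)]
    gcongr
    exact hSV N
  rw [hdiv, ENNReal.mul_top hne] at hge
  simp at hge

/-- Successive refinements with divergent total volume hit almost every point of the cube
infinitely often. -/
theorem ae_frequently_mem_cellPosition_preimage {d : ℕ} (B : ℕ → ℕ) (P : ℕ → Set (Fin d → ℝ))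
    (hP : ∀ n, P n ⊆ unitCube d) (hPm : ∀ n, MeasurableSet (P n)) (hB : Monotone B)
    (hcell : ∀ n, IsCellular (B (n + 1)) (cellPosition (B n) ⁻¹' P n))
    (hdiv : ∑' n, volume (P n) = ⊤) :
    ∀ᵐ x ∂(volume : Measure (Fin d → ℝ)), x ∈ unitCube d →
      ∃ᶠ n in atTop, cellPosition (B n) x ∈ P n := by
  have h : ∀ N : ℕ, ∀ᵐ x ∂(volume : Measure (Fin d → ℝ)), x ∈ unitCube d →
      ∃ n, cellPosition (B (n + N)) x ∈ P (n + N) := by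
    intro N
    have htail : ∑' n, volume (P (n + N)) = ⊤ := by
      rw [← ENNReal.summable.sum_add_tsum_nat_add' (k := N), ENNReal.add_eq_top] at hdiv
      refine hdiv.resolve_left (ENNReal.sum_ne_top.2 fun n _ => ?_)
      exact ne_top_of_le_ne_top (by simp [volume_unitCube]) (measure_mono (hP n))
    have h0 := volume_unitCube_diff_iUnion (fun n => B (n + N)) (fun n => P (n + N))
      (fun n => hP _) (fun n => hPm _) (fun m n hmn => hB (by omega))
      (fun n => by simpa only [Nat.add_right_comm n N 1] using hcell (n + N)) htail
    filter_upwards [measure_eq_zero_iff_ae_notMem.1 h0] with x hx hxC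
    by_contra hcon
    refine hx ⟨hxC, fun hmem => hcon ?_⟩
    simpa using hmem
  filter_upwards [ae_all_iff.2 h] with x hx hxC
  refine frequently_atTop.2 fun N => ?_
  obtain ⟨n, hn⟩ := hx N hxC
  exact ⟨n + N, by omega, hn⟩

/-! ### Suprema of bumps and their integrability. -/

/-- The supremum of the functions equal to `2 ^ L n` on `E n` and to `0` elsewhere. -/
noncomputable def supDyadic {α : Type*} (E : ℕ → Set α) (L : ℕ → ℕ) (x : α) : ENNReal :=
  ⨆ n, (E n).indicator (fun _ => ENNReal.ofReal (2 ^ L n)) x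

theorem measurable_supDyadic {α : Type*} [MeasurableSpace α] {E : ℕ → Set α} {L : ℕ → ℕ}
    (hE : ∀ n, MeasurableSet (E n)) : Measurable (supDyadic E L) :=
  Measurable.iSup fun n => measurable_const.indicator (hE n)

theorem le_supDyadic {α : Type*} {E : ℕ → Set α} {L : ℕ → ℕ} {x : α} {n : ℕ} (hx : x ∈ E n) :
    ENNReal.ofReal (2 ^ L n) ≤ supDyadic E L x := by
  refine le_iSup_of_le n ?_
  rw [Set.indicator_of_mem hx]

theorem supDyadic_eq_zero {α : Type*} {E : ℕ → Set α} {L : ℕ → ℕ} {x : α}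
    (hx : ∀ n, x ∉ E n) : supDyadic E L x = 0 := by
  simp [supDyadic, hx]

/-- A single bump accounts for the supremum up to a factor 2. This dominates |f| (log⁺ |f|)^a by a
sum over bumps, with L n + 1 in place of L n. -/
theorem exists_mem_supDyadic_lt {α : Type*} {E : ℕ → Set α} {L : ℕ → ℕ} {x : α}
    (h0 : supDyadic E L x ≠ 0) (ht : supDyadic E L x ≠ ⊤) :
    ∃ n, x ∈ E n ∧ (supDyadic E L x).toReal < 2 ^ (L n + 1) := by
  obtain ⟨n, hn⟩ := lt_iSup_iff.1 (ENNReal.half_lt_self h0 ht)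
  have hx : x ∈ E n := by
    by_contra hx
    simp [hx] at hn
  refine ⟨n, hx, ?_⟩
  rw [Set.indicator_of_mem hx] at hn
  have h := ENNReal.toReal_strict_mono ENNReal.ofReal_ne_top hn
  rw [ENNReal.toReal_ofReal (by positivity), ENNReal.toReal_div] at h
  rw [pow_succ]
  have h2 : (ENNReal.toReal 2) = 2 := by simp
  rw [h2] at h
  change (supDyadic E L x).toReal / 2 < 2 ^ L n at h
  linarith

theorem supDyadic_lt_top_ae {α : Type*} [MeasurableSpace α] {μ : Measure α} {E : ℕ → Set α}
    {L : ℕ → ℕ} (hE : ∀ n, MeasurableSet (E n))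
    (hs : ∑' n, ENNReal.ofReal (2 ^ L n) * μ (E n) ≠ ⊤) : ∀ᵐ x ∂μ, supDyadic E L x < ⊤ := by
  refine ae_lt_top (measurable_supDyadic hE) (ne_top_of_le_ne_top hs ?_)
  calc ∫⁻ x, supDyadic E L x ∂μ
      ≤ ∫⁻ x, ∑' n, (E n).indicator (fun _ => ENNReal.ofReal (2 ^ L n)) x ∂μ :=
        lintegral_mono fun x => iSup_le fun n => ENNReal.le_tsum n
    _ = ∑' n, ENNReal.ofReal (2 ^ L n) * μ (E n) := by
        rw [lintegral_tsum fun n => (measurable_const.indicator (hE n)).aemeasurable]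
        refine tsum_congr fun n => ?_
        rw [lintegral_indicator_const (hE n)]

theorem supDyadic_toReal_mem_LLogL {d a : ℕ} {E : ℕ → Set (Fin d → ℝ)} {L : ℕ → ℕ}
    (hE : ∀ n, MeasurableSet (E n))
    (hs : ∑' n, ENNReal.ofReal (2 ^ (L n + 1) * (L n + 1) ^ a) * volume (E n) ≠ ⊤) :
    (fun x => (supDyadic E L x).toReal) ∈ LLogL d a := by
  have hm : Measurable fun x => (supDyadic E L x).toReal := (measurable_supDyadic hE).ennreal_toReal
  refine ⟨hm.aestronglyMeasurable, ?_⟩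
  have hFm : Measurable fun x => |(supDyadic E L x).toReal| *
      Real.posLog |(supDyadic E L x).toReal| ^ a := by
    have h1 : Measurable fun x => |(supDyadic E L x).toReal| := hm.abs
    have h2 : Measurable fun x => Real.posLog |(supDyadic E L x).toReal| :=
      measurable_const.max (Real.measurable_log.comp h1)
    exact h1.mul (h2.pow_const a)
  refine ⟨hFm.aestronglyMeasurable, ?_⟩
  rw [hasFiniteIntegral_iff_ofReal (Eventually.of_forall fun x =>
    mul_nonneg (abs_nonneg _) (pow_nonneg Real.posLog_nonneg a))]
  refine lt_of_le_of_lt ?_ hs.lt_top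
  calc _ ≤ ∫⁻ x, ∑' n, (E n).indicator
        (fun _ => ENNReal.ofReal (2 ^ (L n + 1) * (L n + 1) ^ a)) x := by
        refine lintegral_mono fun x => ?_
        by_cases h0 : (supDyadic E L x).toReal = 0
        · simp [h0]
        obtain ⟨h0', ht⟩ := not_or.1 (mt (ENNReal.toReal_eq_zero_iff _).2 h0)
        obtain ⟨n, hx, hlt⟩ := exists_mem_supDyadic_lt h0' ht
        refine le_trans ?_ (ENNReal.le_tsum n)
        rw [Set.indicator_of_mem hx]
        refine ENNReal.ofReal_le_ofReal ?_
        rw [abs_of_nonneg ENNReal.toReal_nonneg]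
        have hlog : Real.posLog (supDyadic E L x).toReal ≤ L n + 1 := by
          refine (Real.posLog_le_posLog ENNReal.toReal_nonneg hlt.le).trans ?_
          rw [Real.posLog_eq_log (by rw [abs_of_nonneg (by positivity)]
                                     exact one_le_pow₀ (by norm_num)), Real.log_pow]
          push_cast
          have := Real.log_two_lt_d9
          nlinarith [(Nat.cast_nonneg (L n) : (0 : ℝ) ≤ L n)]
        have := pow_le_pow_left₀ Real.posLog_nonneg hlog a
        exact mul_le_mul hlt.le this (pow_nonneg Real.posLog_nonneg a) (by positivity)
    _ = _ := by
        rw [lintegral_tsum fun n => (measurable_const.indicator (hE n)).aemeasurable]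
        refine tsum_congr fun n => ?_
        rw [lintegral_indicator_const (hE n)]

/-! ### Volume of the staircase against the cost of a bump. -/

/-- The side exponents of a box of volume `2 ^ ((a + 2) * r)`. -/
def boxExponent {a r : ℕ} (g : Fin (a + 1) → Fin r) : Fin (a + 2) → ℕ :=
  Fin.cons ((a + 2) * r - ∑ i, (g i : ℕ)) fun i => (g i : ℕ)

theorem sum_boxExponent {a r : ℕ} (g : Fin (a + 1) → Fin r) :
    ∑ i, boxExponent g i = (a + 2) * r := by
  have : ∑ i, (g i : ℕ) ≤ (a + 1) * r := by
    refine (Finset.sum_le_card_nsmul _ _ r fun i _ => (g i).2.le).trans ?_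
    simp
  rw [Fin.sum_univ_succ]
  simp only [boxExponent, Fin.cons_zero, Fin.cons_succ]
  have h2 : (a + 1) * r ≤ (a + 2) * r := Nat.mul_le_mul_right _ (by omega)
  omega

theorem boxExponent_le {a r : ℕ} (g : Fin (a + 1) → Fin r) (i : Fin (a + 2)) :
    boxExponent g i ≤ (a + 2) * r := by
  rw [← sum_boxExponent g]
  exact Finset.single_le_sum (f := boxExponent g) (fun _ _ => Nat.zero_le _) (Finset.mem_univ i)

/-- A union of boxes of equal volume with a common corner. -/
def staircase (a r : ℕ) : Set (Fin (a + 2) → ℝ) :=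
  ⋃ g : Fin (a + 1) → Fin r,
    Set.pi Set.univ fun i => Set.Ico (0 : ℝ) (2 ^ boxExponent g i / 2 ^ ((a + 2) * r))

theorem staircase_subset_unitCube (a r : ℕ) : staircase a r ⊆ unitCube (a + 2) := by
  refine Set.iUnion_subset fun g => Set.pi_mono fun i _ => Set.Ico_subset_Ico_right ?_
  rw [div_le_one (by positivity)]
  exact pow_le_pow_right₀ (by norm_num) (boxExponent_le g i)

theorem measurableSet_staircase (a r : ℕ) : MeasurableSet (staircase a r) :=
  MeasurableSet.iUnion fun _ => MeasurableSet.univ_pi fun _ => measurableSet_Ico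

/-- The upper halves, in every coordinate, of the r^(a+1) boxes are disjoint: different dyadic
exponents give disjoint half-intervals, and the last a + 1 exponents determine g. -/
theorem le_volume_staircase (a r : ℕ) :
    ENNReal.ofReal ((r : ℝ) ^ (a + 1) * (2 ^ ((a + 2) * r) / (2 ^ ((a + 2) * r + 1)) ^ (a + 2))) ≤
      volume (staircase a r) := by
  set L := (a + 2) * r with hL
  set Q : (Fin (a + 1) → Fin r) → Set (Fin (a + 2) → ℝ) := fun g =>
    Set.pi Set.univ fun i => Set.Ico ((2 : ℝ) ^ boxExponent g i / 2 ^ (L + 1))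
      (2 ^ boxExponent g i / 2 ^ L) with hQ
  have hhalf : ∀ e : ℕ, (2 : ℝ) ^ e / 2 ^ L - 2 ^ e / 2 ^ (L + 1) = 2 ^ e / 2 ^ (L + 1) := by
    intro e
    rw [pow_succ]
    field_simp
    norm_num
  have hvol : ∀ g, volume (Q g) = ENNReal.ofReal (2 ^ L / (2 ^ (L + 1)) ^ (a + 2)) := by
    intro g
    simp only [hQ, Real.volume_pi_Ico, hhalf]
    rw [← ENNReal.ofReal_prod_of_nonneg (fun i _ => by positivity), Finset.prod_div_distrib,
      Finset.prod_pow_eq_pow_sum, sum_boxExponent]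
    simp [hL]
  have hdisj : Pairwise fun g g' => Disjoint (Q g) (Q g') := by
    have key : ∀ (t : ℝ) (m n : ℕ), m < n → t < 2 ^ m / 2 ^ L → ¬ (2 ^ n / 2 ^ (L + 1) ≤ t) := by
      intro t m n hmn h1 h2
      have h3 : (2 : ℝ) ^ (m + 1) ≤ 2 ^ n := pow_le_pow_right₀ (by norm_num) hmn
      have h4 : (2 : ℝ) ^ m / 2 ^ L = 2 ^ (m + 1) / 2 ^ (L + 1) := by
        rw [pow_succ, pow_succ]
        field_simp
      have h5 : (2 : ℝ) ^ (m + 1) / 2 ^ (L + 1) ≤ 2 ^ n / 2 ^ (L + 1) := by gcongr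
      linarith
    intro g g' hne
    refine Set.disjoint_left.2 fun x hx hx' => hne ?_
    ext i
    have h1 := hx i.succ trivial
    have h2 := hx' i.succ trivial
    simp only [boxExponent, Fin.cons_succ] at h1 h2
    rcases lt_trichotomy (g i : ℕ) (g' i) with h | h | h
    · exact (key _ _ _ h h1.2 h2.1).elim
    · exact h
    · exact (key _ _ _ h h2.2 h1.1).elim
  calc _ = ∑ g, volume (Q g) := by
        simp only [hvol, Finset.sum_const, Finset.card_univ, Fintype.card_fun, Fintype.card_fin,
          nsmul_eq_mul]
        rw [ENNReal.ofReal_mul (by positivity), ENNReal.ofReal_pow (by positivity),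
          ENNReal.ofReal_natCast]
        push_cast
        rfl
    _ = volume (⋃ g, Q g) := by
        rw [measure_iUnion hdisj fun g => MeasurableSet.univ_pi fun _ => measurableSet_Ico,
          tsum_fintype]
    _ ≤ volume (staircase a r) := by
        refine measure_mono (Set.iUnion_mono fun g => Set.pi_mono fun i _ => ?_)
        exact Set.Ico_subset_Ico_left (by positivity)

theorem exists_le_mul_volume_staircase (a : ℕ) {ε : ENNReal} (hε : ε ≠ 0) :
    ∃ r : ℕ, 1 ≤ r ∧
      ENNReal.ofReal (2 ^ ((a + 2) * r + 1) * ((((a + 2) * r : ℕ) : ℝ) + 1) ^ a *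
        (1 / 2 ^ ((a + 2) * r)) ^ (a + 2)) ≤ ε * volume (staircase a r) := by
  obtain ⟨δ, hδ0, hδ⟩ := ENNReal.lt_iff_exists_nnreal_btwn.1 (pos_iff_ne_zero.2 hε)
  have hδ0 : (0 : ℝ) < δ := by exact_mod_cast hδ0
  -- The cost-to-volume ratio is at most 2 · 2^(a+2) (a+3)^a / r: the power 2^(a+2) comes from
  -- halving the sides, and (a+3)^a from L + 1 ≤ (a+3) r. The summand 1 forces r ≥ 1.
  obtain ⟨r, hr⟩ := exists_nat_ge ((2 : ℝ) ^ (a + 3) * (a + 3) ^ a / δ + 1)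
  have hr1' : (1 : ℝ) ≤ r := le_trans (by
    have : (0 : ℝ) ≤ (2 : ℝ) ^ (a + 3) * (a + 3) ^ a / δ := by positivity
    linarith) hr
  have hr1 : 1 ≤ r := by exact_mod_cast hr1'
  refine ⟨r, hr1, ?_⟩
  have hrδ : (2 : ℝ) ^ (a + 3) * (a + 3) ^ a ≤ δ * r := by
    rw [← div_le_iff₀' hδ0]
    linarith
  refine le_trans ?_ (mul_le_mul' hδ.le (le_volume_staircase a r))
  rw [← ENNReal.ofReal_coe_nnreal, ← ENNReal.ofReal_mul hδ0.le]
  refine ENNReal.ofReal_le_ofReal ?_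
  have h1 : ((((a + 2) * r : ℕ) : ℝ) + 1) ^ a ≤ ((a + 3) * r) ^ a := by
    refine pow_le_pow_left₀ (by positivity) ?_ a
    push_cast
    nlinarith
  set L := (a + 2) * r
  have hT : (0 : ℝ) < 2 ^ L := by positivity
  have h2 : (2 : ℝ) ^ (L + 1) = 2 ^ L * 2 := pow_succ _ _
  rw [h2]
  generalize (2 : ℝ) ^ L = T at *
  calc T * 2 * ((L : ℝ) + 1) ^ a * (1 / T) ^ (a + 2)
      ≤ T * 2 * ((a + 3) * r) ^ a * (1 / T) ^ (a + 2) := by gcongr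
    _ = (2 ^ (a + 3) * (a + 3) ^ a) * (r ^ a * (T / (T * 2) ^ (a + 2))) := by
        rw [mul_pow, mul_pow, one_div, inv_pow]
        field_simp
        ring
    _ ≤ (δ * r) * (r ^ a * (T / (T * 2) ^ (a + 2))) := by gcongr
    _ = _ := by ring

/-! ### Dyadic boxes at the corner of a cell. -/

/-- The half-open cube of side `2 ^ (-c)` at the origin. -/
def cornerCube (d c : ℕ) : Set (Fin d → ℝ) := Set.pi Set.univ fun _ => Set.Ico 0 (1 / 2 ^ c)

theorem measurableSet_cornerCube (d c : ℕ) : MeasurableSet (cornerCube d c) :=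
  MeasurableSet.univ_pi fun _ => measurableSet_Ico

theorem cornerCube_subset_unitCube (d c : ℕ) : cornerCube d c ⊆ unitCube d :=
  Set.pi_mono fun _ _ => Set.Ico_subset_Ico_right
    (by rw [div_le_one (by positivity)]; exact one_le_pow₀ (by norm_num))

theorem volume_cornerCube (d c : ℕ) :
    volume (cornerCube d c) = ENNReal.ofReal ((1 / 2 ^ c) ^ d) := by
  rw [cornerCube, Real.volume_pi_Ico, ENNReal.ofReal_pow (by positivity)]
  simp

/-- The box starts at the corner of cell q; the condition e i ≤ c makes this corner a multiple of
its side. -/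
theorem mem_dyadicInterval_iff {d b c : ℕ} {e : Fin d → ℕ} (he : ∀ i, e i ≤ c) (q : Fin d → ℤ)
    (x : Fin d → ℝ) :
    x ∈ dyadicInterval (fun i => -((b : ℤ) + c) + e i) (fun i => q i * 2 ^ (c - e i)) ↔
      ∀ i, (q i : ℝ) ≤ 2 ^ b * x i ∧ 2 ^ b * x i < q i + 2 ^ e i / 2 ^ c := by
  simp only [dyadicInterval, Set.mem_univ_pi, Set.mem_Ico]
  refine forall_congr' fun i => ?_
  have h1 : (2 : ℝ) ^ (-((b : ℤ) + c) + e i) = 2 ^ e i / (2 ^ b * 2 ^ c) := by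
    rw [zpow_add₀ (by norm_num), zpow_neg, zpow_add₀ (by norm_num)]
    simp only [zpow_natCast]
    field_simp
  have h2 : (2 : ℝ) ^ (c - e i) = 2 ^ c / 2 ^ e i := by
    rw [eq_div_iff (by positivity), ← pow_add, Nat.sub_add_cancel (he i)]
  push_cast
  rw [h1, h2]
  have hb : (0 : ℝ) < 2 ^ b := by positivity
  have e1 : (q i : ℝ) * (2 ^ c / 2 ^ e i) * (2 ^ e i / (2 ^ b * 2 ^ c)) = q i / 2 ^ b := by
    field_simp
  have e2 : ((q i : ℝ) * (2 ^ c / 2 ^ e i) + 1) * (2 ^ e i / (2 ^ b * 2 ^ c)) =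
      (q i + 2 ^ e i / 2 ^ c) / 2 ^ b := by
    field_simp
  rw [e1, e2, div_le_iff₀' hb, lt_div_iff₀' hb]

/-- Every point of the rescaled staircase lies in a dyadic box that meets the support of the
bump in the right proportion. -/
theorem exists_dyadicInterval_of_mem_staircase {a b r : ℕ} {x : Fin (a + 2) → ℝ}
    (hx : x ∈ unitCube (a + 2)) (hs : cellPosition b x ∈ staircase a r) :
    ∃ v j w i : Fin (a + 2) → ℤ,
      (∀ l, -((b + (a + 2) * r : ℕ) : ℤ) ≤ v l) ∧ (∀ l, v l ≤ -(b : ℤ)) ∧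
      x ∈ dyadicInterval v j ∧ dyadicInterval w i ⊆ dyadicInterval v j ∧
      dyadicInterval w i ⊆
        unitCube (a + 2) ∩ cellPosition b ⁻¹' cornerCube (a + 2) ((a + 2) * r) ∧
      volume.real (dyadicInterval v j) = 2 ^ ((a + 2) * r) * volume.real (dyadicInterval w i) := by
  obtain ⟨g, hg⟩ := Set.mem_iUnion.1 hs
  have hge := boxExponent_le g
  have hsum := sum_boxExponent g
  set c := (a + 2) * r
  have h0 : ∀ l : Fin (a + 2), (fun _ : Fin (a + 2) => 0) l ≤ c := fun _ => Nat.zero_le _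
  -- The small cube is the case of zero exponents, placed at the corner of the cell of x.
  refine ⟨fun l => -((b : ℤ) + c) + boxExponent g l,
    fun l => cellIndex b x l * 2 ^ (c - boxExponent g l),
    fun l => -((b : ℤ) + c) + ((fun _ : Fin (a + 2) => (0 : ℕ)) l : ℕ),
    fun l => cellIndex b x l * 2 ^ (c - (fun _ : Fin (a + 2) => (0 : ℕ)) l),
    fun l => ?_, fun l => ?_, ?_, ?_, ?_, ?_⟩
  · push_cast
    omega
  · have := hge l
    dsimp only
    omega
  · rw [mem_dyadicInterval_iff hge]
    intro l
    have h1 := (hg l trivial).2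
    simp only [cellPosition, Int.fract] at h1
    exact ⟨Int.floor_le _, by simp only [cellIndex]; linarith⟩
  · intro y hy
    rw [mem_dyadicInterval_iff h0] at hy
    rw [mem_dyadicInterval_iff hge]
    refine fun l => ⟨(hy l).1, (hy l).2.trans_le ?_⟩
    gcongr
    · norm_num
    · omega
  · intro y hy
    rw [mem_dyadicInterval_iff h0] at hy
    have hlt : (1 : ℝ) / 2 ^ c ≤ 1 := by
      rw [div_le_one (by positivity)]
      exact one_le_pow₀ (by norm_num)
    have hfl : cellIndex b y = cellIndex b x := by
      ext l
      have := hy l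
      simp only [pow_zero] at this
      rw [cellIndex, Int.floor_eq_iff]
      exact ⟨this.1, by linarith [this.2]⟩
    refine ⟨isCellular_unitCube _ b hfl.symm hx, fun l _ => ⟨Int.fract_nonneg _, ?_⟩⟩
    have h1 := (hy l).2
    simp only [pow_zero] at h1
    have h2 : cellPosition b y l = 2 ^ b * y l - cellIndex b x l := by
      rw [← hfl]
      rfl
    rw [h2]
    linarith
  · simp only [Measure.real, volume_dyadicInterval]
    rw [ENNReal.toReal_ofReal (by positivity), ENNReal.toReal_ofReal (by positivity),
      ← zpow_natCast (2 : ℝ) c, ← zpow_add₀ (by norm_num), Finset.sum_add_distrib,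
      Finset.sum_add_distrib, ← Nat.cast_sum, hsum]
    congr 1
    simp
    ring

/-! ### The counterexample. -/

theorem not_differentiates_levelExponent {a k : ℕ} (hk : 2 ≤ k) {ρ : ℕ → ℕ} (hρ1 : ∀ n, 1 ≤ ρ n)
    (hsmall : ∑' n, ENNReal.ofReal (2 ^ ((a + 2) * ρ n + 1) *
      ((((a + 2) * ρ n : ℕ) : ℝ) + 1) ^ a * (1 / 2 ^ ((a + 2) * ρ n)) ^ (a + 2)) < 1)
    (hdiv : ∑' n, volume (staircase a (ρ n)) = ⊤) :
    ∃ top : ℤ → ℤ, Monotone top ∧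
      ¬ Differentiates (dyadicBasis fun i : Fin (a + 2) => levelExponent (k := k) hk top i)
        (LLogL (a + 2) a) := by
  set L : ℕ → ℕ := fun n => (a + 2) * ρ n with hL
  set B : ℕ → ℕ := fun n => ∑ m ∈ Finset.range n, L m with hBdef
  have hBsucc : ∀ n, B (n + 1) = B n + L n := fun n => Finset.sum_range_succ _ _
  have hBmono : Monotone B := monotone_nat_of_le_succ fun n => by rw [hBsucc]; omega
  have hBge : ∀ n, n ≤ B n := by
    intro n
    induction n with
    | zero => exact Nat.zero_le _
    | succ n ih =>
      rw [hBsucc]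
      have : 1 ≤ L n := Nat.mul_pos (by omega) (hρ1 n)
      omega
  set E : ℕ → Set (Fin (a + 2) → ℝ) := fun n =>
    unitCube (a + 2) ∩ cellPosition (B n) ⁻¹' cornerCube (a + 2) (L n) with hEdef
  have hEm : ∀ n, MeasurableSet (E n) := fun n => (measurableSet_unitCube _).inter
    (measurable_cellPosition _ (measurableSet_cornerCube _ _))
  have hEvol : ∀ n, volume (E n) = ENNReal.ofReal ((1 / 2 ^ L n) ^ (a + 2)) := by
    intro n
    rw [hEdef, volume_inter_cellPosition_preimage (isCellular_unitCube _ _)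
      (measurableSet_unitCube _) (cornerCube_subset_unitCube _ _) (measurableSet_cornerCube _ _),
      volume_unitCube, one_mul, volume_cornerCube]
  have hsum : ∑' n, ENNReal.ofReal (2 ^ (L n + 1) * (L n + 1) ^ a) * volume (E n) < 1 := by
    refine lt_of_eq_of_lt (tsum_congr fun n => ?_) hsmall
    rw [hEvol, ← ENNReal.ofReal_mul (by positivity)]
  have hpow1 : ∀ n, (1 : ℝ) ≤ ((L n : ℝ) + 1) ^ a := fun n => one_le_pow₀ (by simp)
  have hpow2 : ∀ n, (1 : ℝ) ≤ 2 ^ L n := fun n => one_le_pow₀ (by norm_num)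
  have hsum1 : ∑' n, ENNReal.ofReal (2 ^ (L n + 1) * (L n + 1) ^ 0) * volume (E n) < 1 := by
    refine (ENNReal.tsum_le_tsum fun n => ?_).trans_lt hsum
    rw [pow_zero]
    gcongr
    exact hpow1 n
  have hsum2 : ∑' n, ENNReal.ofReal (2 ^ L n) * volume (E n) < 1 := by
    refine (ENNReal.tsum_le_tsum fun n => ?_).trans_lt hsum1
    gcongr
    rw [pow_zero, mul_one, pow_succ]
    linarith [hpow2 n]
  have hEunion : volume (⋃ n, E n) < 1 := by
    refine (measure_iUnion_le _).trans_lt ((ENNReal.tsum_le_tsum fun n => ?_).trans_lt hsum2)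
    refine le_mul_of_one_le_left zero_le ?_
    exact ENNReal.one_le_ofReal.2 (hpow2 n)
  set f : (Fin (a + 2) → ℝ) → ℝ := fun x => (supDyadic E L x).toReal with hf
  have hfmem : f ∈ LLogL (a + 2) a := supDyadic_toReal_mem_LLogL hEm hsum.ne_top
  -- Exponent 0 in the same criterion gives integrability of f itself.
  have hfint : Integrable f := by
    have := (supDyadic_toReal_mem_LLogL (a := 0) hEm hsum1.ne_top).2
    simp only [pow_zero, mul_one] at this
    refine (integrable_congr (Eventually.of_forall fun x => ?_)).1 this
    exact abs_of_nonneg ENNReal.toReal_nonneg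
  -- Only almost everywhere: where the supremum is infinite, `toReal` returns 0.
  have hfge : ∀ᵐ x ∂(volume : Measure (Fin (a + 2) → ℝ)), ∀ n, x ∈ E n → (2 : ℝ) ^ L n ≤ f x := by
    filter_upwards [supDyadic_lt_top_ae hEm hsum2.ne_top] with x hx n hxn
    have := ENNReal.toReal_mono hx.ne (le_supDyadic (L := L) hxn)
    rwa [ENNReal.toReal_ofReal (by positivity)] at this
  -- Level -n has the window [-B (n + 1), -B n], so the scales shrink as the level tends to -∞.
  set top : ℤ → ℤ := fun c => -(B (-c).toNat : ℤ) with htop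
  have htopm : Monotone top := by
    intro c c' h
    have : B (-c').toNat ≤ B (-c).toNat := hBmono (by omega)
    simp only [htop]
    omega
  refine ⟨top, htopm, fun hdiff => ?_⟩
  have hfreq := ae_frequently_mem_cellPosition_preimage B (fun n => staircase a (ρ n))
    (fun n => staircase_subset_unitCube a _) (fun n => measurableSet_staircase a _) hBmono
    (fun n => by rw [hBsucc]; exact isCellular_cellPosition_preimage _ _ _) hdiv
  obtain ⟨x, hxC, hxE, hxfreq, hxlim⟩ : ∃ x, x ∈ unitCube (a + 2) ∧ x ∉ ⋃ n, E n ∧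
      (∃ᶠ n in atTop, cellPosition (B n) x ∈ staircase a (ρ n)) ∧
      ∀ R : ℕ → Set (Fin (a + 2) → ℝ), (∀ n, R n ∈
        dyadicBasis (fun i : Fin (a + 2) => levelExponent (k := k) hk top i) ∧ x ∈ R n) →
      Tendsto (fun n => Metric.ediam (R n)) atTop (𝓝 0) →
      Tendsto (fun n => (volume.real (R n))⁻¹ * ∫ y in R n, f y) atTop (𝓝 (f x)) := by
    by_contra hcon
    push Not at hcon
    have hsub : ∀ᵐ x ∂(volume : Measure (Fin (a + 2) → ℝ)), x ∈ unitCube (a + 2) →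
        x ∈ ⋃ n, E n := by
      filter_upwards [hfreq, hdiff f hfmem] with x h1 h2 hxC
      by_contra hxE
      obtain ⟨R, hR1, hR2, hR3⟩ := hcon x hxC hxE (h1 hxC)
      exact hR3 (h2 R hR1 hR2)
    have := measure_mono_ae (μ := volume) (s := unitCube (a + 2)) (t := ⋃ n, E n) hsub
    rw [volume_unitCube] at this
    exact absurd hEunion this.not_gt
  obtain ⟨φ, hφ, hφs⟩ := extraction_of_frequently_atTop hxfreq
  choose v j w i hv1 hv2 hxv hwv hwE hvol using
    fun n => exists_dyadicInterval_of_mem_staircase hxC (hφs n)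
  have hlim := hxlim (fun n => dyadicInterval (v n) (j n)) (fun n => ⟨?_, hxv n⟩) ?_
  · have hfx : f x = 0 := by
      simp only [Set.mem_iUnion, not_exists] at hxE
      simp [hf, supDyadic_eq_zero hxE]
    rw [hfx] at hlim
    -- Each box contains a cube with 2^L times less volume on which f ≥ 2^L almost everywhere, so
    -- its average is at least 1.
    refine absurd (ge_of_tendsto' hlim (b := 1) fun n => ?_) (by norm_num)
    have hwvol : 0 < volume.real (dyadicInterval (w n) (i n)) := by
      rw [Measure.real, volume_dyadicInterval, ENNReal.toReal_ofReal (by positivity)]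
      positivity
    have hwfin : volume (dyadicInterval (w n) (i n)) ≠ ⊤ := by
      rw [volume_dyadicInterval]
      exact ENNReal.ofReal_ne_top
    rw [← div_eq_inv_mul, one_le_div (by rw [hvol]; positivity), hvol]
    calc _ = ∫ _ in dyadicInterval (w n) (i n), (2 : ℝ) ^ L (φ n) := by
          rw [setIntegral_const, smul_eq_mul, mul_comm]
      _ ≤ ∫ y in dyadicInterval (w n) (i n), f y := by
          refine setIntegral_mono_on_ae (integrableOn_const hwfin) hfint.integrableOn
            (measurableSet_dyadicInterval _ _) ?_
          filter_upwards [hfge] with y hy hyw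
          exact hy _ (hwE n hyw)
      _ ≤ _ := setIntegral_mono_set hfint.integrableOn
          (Eventually.of_forall fun y => ENNReal.toReal_nonneg) (hwv n).eventuallyLE
  · have h1 : top (-(φ n : ℤ) - 1) = -((B (φ n) + L (φ n) : ℕ) : ℤ) := by
      rw [← hBsucc]
      simp only [htop]
      congr 3
      omega
    have h2 : top (-(φ n : ℤ)) = -(B (φ n) : ℤ) := by simp [htop]
    obtain ⟨m, hm⟩ := exists_levelExponent_eq hk top (-(φ n : ℤ)) (v n)
      (fun l => by rw [h1]; exact hv1 n l) (fun l => by rw [h2]; exact hv2 n l)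
    exact ⟨m, j n, by rw [hm]⟩
  · have hbound : ∀ n, Metric.ediam (dyadicInterval (v n) (j n)) ≤
        ENNReal.ofReal ((1 / 2 : ℝ) ^ n) := by
      intro n
      refine (ediam_dyadicInterval_le _ _ (-(n : ℤ)) fun l => (hv2 n l).trans ?_).trans ?_
      · have := (hφ.id_le n).trans (hBge (φ n))
        simp only [id] at this
        omega
      · simp
    refine tendsto_of_tendsto_of_tendsto_of_le_of_le tendsto_const_nhds ?_
      (fun n => zero_le) hbound
    rw [← ENNReal.ofReal_zero]
    exact ENNReal.tendsto_ofReal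
      (tendsto_pow_atTop_nhds_zero_of_lt_one (by norm_num) (by norm_num))

end ZygmundBasis

theorem theorem1 (k d : ℕ) (hk : 2 ≤ k) (hkd : k ≤ d) :
    ∃ Φ : Fin d → (Fin k → ℤ) → ℤ,
      (∀ i, ZygmundBasis.NondecreasingInEachVariable (Φ i)) ∧
      ¬ ZygmundBasis.Differentiates (ZygmundBasis.dyadicBasis Φ)
          (ZygmundBasis.LLogL d (d - 2)) := by
  obtain ⟨a, rfl⟩ := Nat.exists_eq_add_of_le' (hk.trans hkd)
  obtain ⟨ρ, hρ1, hρs, hρd⟩ := ZygmundBasis.exists_seq_tsum_lt_one_tsum_eq_top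
    (fun r => ENNReal.ofReal (2 ^ ((a + 2) * r + 1) * ((((a + 2) * r : ℕ) : ℝ) + 1) ^ a *
        (1 / 2 ^ ((a + 2) * r)) ^ (a + 2)))
    (fun r => volume (ZygmundBasis.staircase a r))
    (fun r => (measure_mono (ZygmundBasis.staircase_subset_unitCube a r)).trans
      (ZygmundBasis.volume_unitCube _).le)
    (fun r hr => by
      refine (lt_of_lt_of_le ?_ (ZygmundBasis.le_volume_staircase a r)).ne'
      rw [ENNReal.ofReal_pos]
      have : (0 : ℝ) < r := by exact_mod_cast hr
      positivity)
    (fun ε hε => ZygmundBasis.exists_le_mul_volume_staircase a hε)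
  obtain ⟨top, htop, hnot⟩ :=
    ZygmundBasis.not_differentiates_levelExponent (a := a) hk hρ1 hρs hρd
  exact ⟨fun i => ZygmundBasis.levelExponent hk top i,
    fun i => ZygmundBasis.levelExponent_nondecreasing hk htop i, hnot⟩
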